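/- Let $N = pq$, where $p$ and $q$ are distinct primes. Let $\sqrt N = [a_0, \overline{a_1, \ldots, a_\tau}]$ be the continued fraction expansion of $\sqrt N$, where $\tau \ge 1$ is its (least) period, i.e. the least positive integer with $a_{m+\tau} = a_m$ for all $m \ge 1$. Define integers $P_m, Q_m$ by $P_0 = 0$, $Q_0 = 1$ and, for $m \ge 0$, $$P_{m+1} = \left\lfloor \frac{P_m + \sqrt N}{Q_m} \right\rfloor Q_m - P_m, \qquad Q_{m+1} = \frac{N - P_{m+1}^2}{Q_m}.$$ We say that an integer $x$ contains a nontrivial factor of $N$ if $1 < \gcd(x, N) < N$. Then: 1. If $p \equiv q \equiv 3 \pmod 4$, then $\tau$ is even and $Q_{\tau/2}$ contains a nontrivial factor of $N$. 2. If $p \equiv 5 \pmod 8$ and $q \equiv 3 \pmod 4$, then $\tau$ is even and $Q_{\tau/2}$ contains a nontrivial factor of $N$. 3. If $p \equiv q \equiv 1 \pmod 4$ and $\tau$ is even, then $Q_{\tau/2}$ contains a nontrivial factor of $N$. -/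

import Mathlib

/-- The pair `(P_m, Q_m)` produced at step `m` by the Lagrange algorithm for `√N`:
`P_0 = 0`, `Q_0 = 1`, `a_m = ⌊(P_m + √N) / Q_m⌋`, `P_{m+1} = a_m Q_m - P_m` and
`Q_{m+1} = (N - P_{m+1}^2) / Q_m`. For `N` not a perfect square, the last division is exact
(and `Q_m` is positive). -/
noncomputable def lagrangePQ (N : ℕ) : ℕ → ℤ × ℤ
  | 0 => (0, 1)
  | m + 1 =>
    let P := (lagrangePQ N m).1
    let Q := (lagrangePQ N m).2
    let a : ℤ := ⌊((P : ℝ) + √(N : ℝ)) / (Q : ℝ)⌋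
    let P' := a * Q - P
    (P', ((N : ℤ) - P' ^ 2) / Q)

/-- The integer `Q_m` of the Lagrange algorithm for `√N`. -/
noncomputable def lagrangeQ (N m : ℕ) : ℤ := (lagrangePQ N m).2

/-- The period `τ` of the continued fraction expansion `√N = [a_0, a_1, a_2, …]`: the least
positive `t` with `a_{m+t} = a_m` for all `m ≥ 1`. Entry number `m` of `partDens` is the partial
quotient `a_{m+1}`, so that the integer part `a_0` is left out. -/
noncomputable def sqrtPeriod (N : ℕ) : ℕ :=
  sInf {t : ℕ | 0 < t ∧
    Function.Periodic (fun m : ℕ => (GenContFract.of √(N : ℝ)).partDens.get? m) t}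

/-- The integer `x` contains a nontrivial factor of `N`: `gcd (x, N)` is a divisor of `N` other
than `1` and `N`. -/
def ContainsNontrivialFactor (x : ℤ) (N : ℕ) : Prop :=
  1 < Int.gcd x (N : ℤ) ∧ Int.gcd x (N : ℤ) < N

/-! Write `τ = 2k`. Over a period the algorithm reads the same backwards, so `P_{k+1} = P_k`; hence
`Q_k ∣ 2 P_k`, and together with `Q_k ∣ N - P_k ^ 2` this gives `Q_k ∣ 2N`
(`lagrangePQ_dvd_of_even_period`). Moreover `Q_k < N`, and `Q_k ≠ 1` by minimality of `τ`, so `gcd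
(Q_k, N) = 1` would force `Q_k = 2`. Congruences in `A ^ 2 - N B ^ 2 = (-1) ^ m Q_m`
(`exists_sq_sub_mul_sq_eq`) exclude this, and also exclude odd `τ` when a prime `≡ 3 mod 4` divides
`N`.

`sqrtPeriod_spec` links the two notions of period: `τ`, defined by partial quotients, is the least
period of the pairs `(P_m, Q_m)` from index `1` on. -/

section Lagrange

/-! ### The Lagrange step and its invariant -/

/-- The complete quotient `(P + √N) / Q` attached to a pair `(P, Q)`. -/
noncomputable def completeQuotient (N : ℕ) (x : ℤ × ℤ) : ℝ := ((x.1 : ℝ) + √(N : ℝ)) / (x.2 : ℝ)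

/-- One step of the Lagrange algorithm. -/
noncomputable def lagrangeStep (N : ℕ) (x : ℤ × ℤ) : ℤ × ℤ :=
  (⌊completeQuotient N x⌋ * x.2 - x.1,
    ((N : ℤ) - (⌊completeQuotient N x⌋ * x.2 - x.1) ^ 2) / x.2)

theorem lagrangePQ_zero (N : ℕ) : lagrangePQ N 0 = (0, 1) := rfl

theorem lagrangePQ_succ (N m : ℕ) :
    lagrangePQ N (m + 1) = lagrangeStep N (lagrangePQ N m) := rfl

theorem lagrangePQ_add_of_eq {N m n : ℕ} (h : lagrangePQ N m = lagrangePQ N n) (i : ℕ) :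
    lagrangePQ N (m + i) = lagrangePQ N (n + i) := by
  induction i with
  | zero => exact h
  | succ i ih => rw [← add_assoc, ← add_assoc, lagrangePQ_succ, lagrangePQ_succ, ih]

/-- The invariant of the Lagrange algorithm: the complete quotient exceeds `1` and its conjugate is
negative. -/
structure Admissible (N : ℕ) (x : ℤ × ℤ) : Prop where
  pos : 0 < x.2
  dvd : x.2 ∣ (N : ℤ) - x.1 ^ 2
  lt : (x.1 : ℝ) < √(N : ℝ)
  lt_add : (x.2 : ℝ) < √(N : ℝ) + x.1

theorem sqrt_ne_intCast {N : ℕ} (hN : ¬ IsSquare N) (z : ℤ) : √(N : ℝ) ≠ z :=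
  (irrational_sqrt_natCast_iff.2 hN).ne_int z

theorem Admissible.one_lt {N : ℕ} {x : ℤ × ℤ} (hx : Admissible N x) :
    1 < completeQuotient N x := by
  have h := hx.lt_add
  have hQ : (0 : ℝ) < x.2 := by exact_mod_cast hx.pos
  rw [completeQuotient, lt_div_iff₀ hQ]
  linarith

theorem Admissible.lagrangeStep_mul {N : ℕ} {x : ℤ × ℤ} (hx : Admissible N x) :
    (lagrangeStep N x).2 * x.2 = (N : ℤ) - (lagrangeStep N x).1 ^ 2 := by
  refine Int.ediv_mul_cancel ?_
  obtain ⟨c, hc⟩ := hx.dvd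
  exact ⟨c - ⌊completeQuotient N x⌋ * (⌊completeQuotient N x⌋ * x.2 - 2 * x.1), by
    linear_combination hc⟩

/-- Everything follows from `√N - Q < P' < √N`, `Q < √N + P'` and `Q' Q = (√N - P') (√N + P')`. The
bound `√N - P' < Q'` stays outside `Admissible` because it fails for the initial pair `(0, 1)`. -/
theorem Admissible.step_bounds {N : ℕ} (hN : ¬ IsSquare N) {x : ℤ × ℤ} (hx : Admissible N x) :
    Admissible N (lagrangeStep N x) ∧
      √(N : ℝ) - (lagrangeStep N x).1 < (lagrangeStep N x).2 ∧
      √(N : ℝ) - (lagrangeStep N x).1 < x.2 := by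
  have hQ : (0 : ℝ) < x.2 := by exact_mod_cast hx.pos
  have hmul := hx.lagrangeStep_mul
  have ha : 1 ≤ ⌊completeQuotient N x⌋ := Int.le_floor.2 (by exact_mod_cast hx.one_lt.le)
  have ha' : (1 : ℝ) ≤ ⌊completeQuotient N x⌋ := by exact_mod_cast ha
  have hP : ((lagrangeStep N x).1 : ℝ) = ⌊completeQuotient N x⌋ * x.2 - x.1 := by
    simp [lagrangeStep]
  have h1 : (⌊completeQuotient N x⌋ : ℝ) * x.2 ≤ x.1 + √(N : ℝ) :=
    (le_div_iff₀ hQ).1 (Int.floor_le (completeQuotient N x))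
  have h2 : x.1 + √(N : ℝ) < (⌊completeQuotient N x⌋ + 1 : ℝ) * x.2 :=
    (div_lt_iff₀ hQ).1 (Int.lt_floor_add_one (completeQuotient N x))
  have h3 : (x.2 : ℝ) ≤ ⌊completeQuotient N x⌋ * x.2 := le_mul_of_one_le_left hQ.le ha'
  have hlt := hx.lt
  have hP1 : ((lagrangeStep N x).1 : ℝ) < √(N : ℝ) :=
    lt_of_le_of_ne (by linarith) (sqrt_ne_intCast hN _).symm
  have hP2 : √(N : ℝ) - (lagrangeStep N x).1 < x.2 := by linarith
  have hP3 : (x.2 : ℝ) < √(N : ℝ) + (lagrangeStep N x).1 := by linarith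
  have hs : √(N : ℝ) ^ 2 = N := Real.sq_sqrt (Nat.cast_nonneg N)
  have hQQ : ((lagrangeStep N x).2 : ℝ) * x.2 =
      (√(N : ℝ) - (lagrangeStep N x).1) * (√(N : ℝ) + (lagrangeStep N x).1) := by
    have : ((lagrangeStep N x).2 : ℝ) * x.2 = N - ((lagrangeStep N x).1 : ℝ) ^ 2 := by
      exact_mod_cast hmul
    rw [this]; linear_combination -hs
  have hpos : (0 : ℝ) < (lagrangeStep N x).2 := by
    refine pos_of_mul_pos_left ?_ hQ.le
    rw [hQQ]
    exact mul_pos (by linarith) (by linarith)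
  refine ⟨⟨by exact_mod_cast hpos, ⟨x.2, hmul.symm⟩, hP1, ?_⟩, ?_, hP2⟩
  · refine lt_of_mul_lt_mul_right ?_ hQ.le
    rw [hQQ, mul_comm]
    exact mul_lt_mul_of_pos_left hP2 (by linarith)
  · refine lt_of_mul_lt_mul_right ?_ hQ.le
    rw [hQQ]
    exact mul_lt_mul_of_pos_left hP3 (by linarith)

variable {N : ℕ}

theorem admissible_lagrangePQ (hN : ¬ IsSquare N) (m : ℕ) : Admissible N (lagrangePQ N m) := by
  induction m with
  | zero =>
    have h2 : 1 < N := by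
      by_contra h
      exact hN (by interval_cases N <;> decide)
    have h1 : (1 : ℝ) < √(N : ℝ) := Real.lt_sqrt_of_sq_lt (by simpa using h2)
    exact ⟨by simp [lagrangePQ_zero], by simp [lagrangePQ_zero],
      by simp only [lagrangePQ_zero, Int.cast_zero]; linarith,
      by simpa [lagrangePQ_zero] using h1⟩
  | succ m ih => exact (ih.step_bounds hN).1

theorem lagrangePQ_mul (hN : ¬ IsSquare N) (m : ℕ) :
    (lagrangePQ N (m + 1)).2 * (lagrangePQ N m).2 = (N : ℤ) - (lagrangePQ N (m + 1)).1 ^ 2 :=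
  (admissible_lagrangePQ hN m).lagrangeStep_mul

theorem sqrt_sub_lt (hN : ¬ IsSquare N) (m : ℕ) :
    √(N : ℝ) - (lagrangePQ N (m + 1)).1 < (lagrangePQ N (m + 1)).2 :=
  ((admissible_lagrangePQ hN m).step_bounds hN).2.1

theorem lagrangePQ_ext (hN : ¬ IsSquare N) {m n : ℕ}
    (h1 : (lagrangePQ N (m + 1)).1 = (lagrangePQ N (n + 1)).1)
    (h2 : (lagrangePQ N m).2 = (lagrangePQ N n).2) :
    lagrangePQ N (m + 1) = lagrangePQ N (n + 1) := by
  refine Prod.ext h1 ?_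
  have hm := lagrangePQ_mul hN m
  rw [h1, h2, ← lagrangePQ_mul hN n] at hm
  exact mul_right_cancel₀ (admissible_lagrangePQ hN n).pos.ne' hm

theorem lagrangePQ_snd_eq (hN : ¬ IsSquare N) {m n : ℕ}
    (h : lagrangePQ N (m + 1) = lagrangePQ N (n + 1)) :
    (lagrangePQ N m).2 = (lagrangePQ N n).2 := by
  have hm := lagrangePQ_mul hN m
  rw [h, ← lagrangePQ_mul hN n] at hm
  exact mul_left_cancel₀ (admissible_lagrangePQ hN (n + 1)).pos.ne' hm

/-! ### Reversibility and periodicity of the pairs -/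

/-- The pair `(P_{m+1}, Q_m)`, which is what the algorithm sees when it is run backwards. -/
noncomputable def reversePQ (N m : ℕ) : ℤ × ℤ := ((lagrangePQ N (m + 1)).1, (lagrangePQ N m).2)

/-- `(P_{m+2} + √N) / Q_{m+1} = a + (√N - P_{m+1}) / Q_{m+1}`, and the last fraction lies in `(0,
1)`; so both directions use the same partial quotient `a`. -/
theorem lagrangeStep_reversePQ (hN : ¬ IsSquare N) (m : ℕ) :
    lagrangeStep N (reversePQ N (m + 1)) = reversePQ N m := by
  have hx := admissible_lagrangePQ hN (m + 1)
  have hQ : (0 : ℝ) < (lagrangePQ N (m + 1)).2 := by exact_mod_cast hx.pos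
  set a := ⌊completeQuotient N (lagrangePQ N (m + 1))⌋ with ha
  have hP : (lagrangePQ N (m + 1 + 1)).1 = a * (lagrangePQ N (m + 1)).2 - (lagrangePQ N (m + 1)).1 :=
    rfl
  have hfl : ⌊completeQuotient N (reversePQ N (m + 1))⌋ = a := by
    have hPr : ((lagrangePQ N (m + 1 + 1)).1 : ℝ) =
        a * (lagrangePQ N (m + 1)).2 - (lagrangePQ N (m + 1)).1 := by exact_mod_cast hP
    rw [Int.floor_eq_iff, completeQuotient, reversePQ, le_div_iff₀ hQ, div_lt_iff₀ hQ]
    dsimp only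
    rw [hPr]
    have h1 := hx.lt
    have h2 := sqrt_sub_lt hN m
    constructor <;> linarith
  have h1 : (lagrangeStep N (reversePQ N (m + 1))).1 = (lagrangePQ N (m + 1)).1 := by
    rw [lagrangeStep, hfl]
    dsimp only [reversePQ]
    rw [hP]; ring
  refine Prod.ext h1 ?_
  change ((N : ℤ) - (lagrangeStep N (reversePQ N (m + 1))).1 ^ 2) / (lagrangePQ N (m + 1)).2 = _
  rw [h1, ← lagrangePQ_mul hN m]
  exact Int.mul_ediv_cancel_left _ hx.pos.ne'

theorem lagrangePQ_pred (hN : ¬ IsSquare N) {m n : ℕ}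
    (h : lagrangePQ N (m + 2) = lagrangePQ N (n + 2)) :
    lagrangePQ N (m + 1) = lagrangePQ N (n + 1) := by
  have hR : reversePQ N (m + 1) = reversePQ N (n + 1) :=
    Prod.ext (by simp only [reversePQ, h]) (lagrangePQ_snd_eq hN h)
  have hR' := congrArg (lagrangeStep N) hR
  rw [lagrangeStep_reversePQ hN, lagrangeStep_reversePQ hN] at hR'
  exact Prod.ext (Prod.ext_iff.1 hR').1 (Prod.ext_iff.1 hR).2

theorem lagrangePQ_mem (hN : ¬ IsSquare N) (m : ℕ) :
    lagrangePQ N (m + 1) ∈ Set.Icc (0 : ℤ) N ×ˢ Set.Icc (0 : ℤ) (2 * N) := by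
  have hx := admissible_lagrangePQ hN (m + 1)
  have h1 := sqrt_sub_lt hN m
  have h2 := hx.lt
  have h3 := hx.lt_add
  have h4 : √(N : ℝ) ≤ N := by
    rw [Real.sqrt_le_left (Nat.cast_nonneg N)]
    exact_mod_cast Nat.le_self_pow two_ne_zero N
  refine ⟨⟨?_, ?_⟩, ⟨hx.pos.le, ?_⟩⟩
  · have : (0 : ℝ) ≤ (lagrangePQ N (m + 1)).1 := by linarith
    exact_mod_cast this
  · have : ((lagrangePQ N (m + 1)).1 : ℝ) ≤ N := by linarith
    exact_mod_cast this
  · have : ((lagrangePQ N (m + 1)).2 : ℝ) ≤ 2 * N := by linarith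
    exact_mod_cast this

/-- Pigeonhole gives some repetition, and `lagrangePQ_pred` carries it back to index `1`. -/
theorem exists_lagrangePQ_period (hN : ¬ IsSquare N) :
    ∃ t, 0 < t ∧ lagrangePQ N (1 + t) = lagrangePQ N 1 := by
  have hfin : (Set.Icc (0 : ℤ) N ×ˢ Set.Icc (0 : ℤ) (2 * N)).Finite :=
    (Set.finite_Icc _ _).prod (Set.finite_Icc _ _)
  obtain ⟨i, j, hij, h⟩ := hfin.exists_lt_map_eq_of_forall_mem (lagrangePQ_mem hN)
  obtain ⟨t, rfl⟩ := Nat.exists_eq_add_of_lt hij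
  refine ⟨t + 1, by omega, ?_⟩
  clear hij
  induction i with
  | zero => rw [h, show 1 + (t + 1) = 0 + t + 1 + 1 by ring]
  | succ i ih =>
    apply ih
    apply lagrangePQ_pred hN
    rw [show i + 2 = i + 1 + 1 by ring, h, show i + 1 + t + 1 + 1 = i + t + 1 + 2 by ring]

/-! ### Comparison with the continued fraction of `√N` -/

theorem completeQuotient_step (hN : ¬ IsSquare N) {x : ℤ × ℤ} (hx : Admissible N x) :
    completeQuotient N (lagrangeStep N x) = (Int.fract (completeQuotient N x))⁻¹ := by
  have hQ : (0 : ℝ) < x.2 := by exact_mod_cast hx.pos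
  have hs := (hx.step_bounds hN).1
  have hQ' : (0 : ℝ) < (lagrangeStep N x).2 := by exact_mod_cast hs.pos
  have hlt := hs.lt
  have hmul : ((lagrangeStep N x).2 : ℝ) * x.2 = N - ((lagrangeStep N x).1 : ℝ) ^ 2 := by
    exact_mod_cast hx.lagrangeStep_mul
  have hP : ((lagrangeStep N x).1 : ℝ) = ⌊completeQuotient N x⌋ * x.2 - x.1 := by
    simp [lagrangeStep]
  have hsq : √(N : ℝ) ^ 2 = N := Real.sq_sqrt (Nat.cast_nonneg N)
  have hfr : Int.fract (completeQuotient N x) = (√(N : ℝ) - (lagrangeStep N x).1) / x.2 := by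
    rw [Int.fract, hP, eq_div_iff hQ.ne', sub_mul]
    rw [show completeQuotient N x * x.2 = x.1 + √(N : ℝ) from div_mul_cancel₀ _ hQ.ne']
    ring
  rw [hfr, inv_div, completeQuotient, div_eq_div_iff hQ'.ne' (by linarith)]
  linear_combination hsq - hmul

theorem of_completeQuotient_get? (hN : ¬ IsSquare N) (n m : ℕ) :
    (GenContFract.of (completeQuotient N (lagrangePQ N m))).s.get? n =
      some ⟨1, ⌊completeQuotient N (lagrangePQ N (m + n + 1))⌋⟩ := by
  have hstep := fun m ↦ completeQuotient_step hN (admissible_lagrangePQ hN m)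
  simp only [← lagrangePQ_succ] at hstep
  induction n generalizing m with
  | zero =>
    have h0 : Int.fract (completeQuotient N (lagrangePQ N m)) ≠ 0 := by
      intro h
      have h1 := (admissible_lagrangePQ hN (m + 1)).one_lt
      rw [hstep, h, inv_zero] at h1
      exact absurd h1 (by norm_num)
    have := GenContFract.of_s_head h0
    rw [← hstep] at this
    exact this
  | succ n ih =>
    rw [GenContFract.of_s_succ, ← hstep, ih, show m + 1 + n + 1 = m + (n + 1) + 1 by ring]

theorem partDens_sqrt (hN : ¬ IsSquare N) (n : ℕ) :
    (GenContFract.of √(N : ℝ)).partDens.get? n =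
      some (⌊completeQuotient N (lagrangePQ N (n + 1))⌋ : ℝ) := by
  have h := of_completeQuotient_get? hN n 0
  rw [show completeQuotient N (lagrangePQ N 0) = √(N : ℝ) by
    simp [completeQuotient, lagrangePQ_zero], zero_add] at h
  rw [GenContFract.partDens, Stream'.Seq.map_get?, h]
  rfl

theorem completeQuotient_inj (hN : ¬ IsSquare N) {x y : ℤ × ℤ} (hx : Admissible N x)
    (hy : Admissible N y) (h : completeQuotient N x = completeQuotient N y) : x = y := by
  have hQ : (0 : ℝ) < x.2 := by exact_mod_cast hx.pos
  have hQ' : (0 : ℝ) < y.2 := by exact_mod_cast hy.pos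
  rw [completeQuotient, completeQuotient, div_eq_div_iff hQ.ne' hQ'.ne'] at h
  have h2 : x.2 = y.2 := by
    by_contra hne
    have hd : y.2 - x.2 ≠ 0 := sub_ne_zero.2 (Ne.symm hne)
    have hd' : ((y.2 - x.2 : ℤ) : ℝ) ≠ 0 := by exact_mod_cast hd
    refine (irrational_sqrt_natCast_iff.2 hN).ne_rat
      (((y.1 * x.2 - x.1 * y.2 : ℤ) : ℚ) / ((y.2 - x.2 : ℤ) : ℚ)) ?_
    rw [Rat.cast_div, Rat.cast_intCast, Rat.cast_intCast, eq_div_iff hd']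
    push_cast
    linear_combination h
  refine Prod.ext ?_ h2
  rw [h2] at h
  have := mul_right_cancel₀ hQ'.ne' h
  exact_mod_cast add_right_cancel this

/-- Equal partial quotients make the distance of two distinct complete quotients grow at each step,
which the periodicity of the pairs forbids. -/
theorem lagrangePQ_eq_of_floor_eq (hN : ¬ IsSquare N) (t : ℕ)
    (h : ∀ m, ⌊completeQuotient N (lagrangePQ N (m + t + 1))⌋ =
      ⌊completeQuotient N (lagrangePQ N (m + 1))⌋) :
    lagrangePQ N (1 + t) = lagrangePQ N 1 := by
  by_contra hne
  set d : ℕ → ℝ := fun m ↦ |completeQuotient N (lagrangePQ N (m + t + 1)) -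
    completeQuotient N (lagrangePQ N (m + 1))| with hd
  have hd0 : 0 < d 0 := by
    refine abs_pos.2 (sub_ne_zero.2 fun heq ↦ hne ?_)
    have := completeQuotient_inj hN (admissible_lagrangePQ hN _) (admissible_lagrangePQ hN _) heq
    rw [add_comm 1 t]
    simpa using this
  have hstep : ∀ m, 0 < d m → d m < d (m + 1) := by
    intro m hm
    have hx := admissible_lagrangePQ hN (m + t + 1)
    have hy := admissible_lagrangePQ hN (m + 1)
    have hx1 := (hx.step_bounds hN).1.one_lt
    have hy1 := (hy.step_bounds hN).1.one_lt
    have ex := completeQuotient_step hN hx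
    have ey := completeQuotient_step hN hy
    have hfx : Int.fract (completeQuotient N (lagrangePQ N (m + t + 1))) =
      (completeQuotient N (lagrangeStep N (lagrangePQ N (m + t + 1))))⁻¹ := by rw [ex, inv_inv]
    have hfy : Int.fract (completeQuotient N (lagrangePQ N (m + 1))) =
      (completeQuotient N (lagrangeStep N (lagrangePQ N (m + 1))))⁻¹ := by rw [ey, inv_inv]
    have hdm : d m = |(completeQuotient N (lagrangeStep N (lagrangePQ N (m + t + 1))))⁻¹ -
        (completeQuotient N (lagrangeStep N (lagrangePQ N (m + 1))))⁻¹| := by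
      rw [← hfx, ← hfy, Int.fract, Int.fract, h m, sub_sub_sub_cancel_right]
    have hdm1 : d (m + 1) = |completeQuotient N (lagrangeStep N (lagrangePQ N (m + t + 1))) -
        completeQuotient N (lagrangeStep N (lagrangePQ N (m + 1)))| := by
      simp only [hd, ← lagrangePQ_succ]
      rw [show m + 1 + t + 1 = m + t + 1 + 1 by ring]
    generalize completeQuotient N (lagrangeStep N (lagrangePQ N (m + t + 1))) = u at *
    generalize completeQuotient N (lagrangeStep N (lagrangePQ N (m + 1))) = v at *
    -- Since `d m = |u⁻¹ - v⁻¹|` and `d (m + 1) = |u - v|`, the growth factor is `u * v`.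
    have huv : 1 < u * v := one_lt_mul_of_lt_of_le hx1 hy1.le
    have key : d (m + 1) = d m * (u * v) := by
      rw [hdm1, hdm, inv_sub_inv (by linarith) (by linarith), abs_div, abs_sub_comm u v,
        abs_of_pos (show 0 < u * v by linarith), div_mul_cancel₀ _ (by linarith)]
    rw [key]
    exact lt_mul_of_one_lt_right hm huv
  have hpos : ∀ m, 0 < d m := by
    intro m
    induction m with
    | zero => exact hd0
    | succ m ih => exact ih.trans (hstep m ih)
  have hmono : StrictMono d := strictMono_nat_of_lt_succ fun m ↦ hstep m (hpos m)
  obtain ⟨r, hr, hper⟩ := exists_lagrangePQ_period hN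
  have hdr : d r = d 0 := by
    have h1 := lagrangePQ_add_of_eq hper t
    rw [show 1 + r + t = r + t + 1 by ring, show 1 + t = 0 + t + 1 by ring] at h1
    simp only [hd]
    rw [h1, add_comm r 1, hper]
  exact (hmono hr).ne' hdr

theorem sqrtPeriod_spec (hN : ¬ IsSquare N) :
    0 < sqrtPeriod N ∧ lagrangePQ N (1 + sqrtPeriod N) = lagrangePQ N 1 ∧
      ∀ t, 0 < t → lagrangePQ N (1 + t) = lagrangePQ N 1 → sqrtPeriod N ≤ t := by
  have hmem : ∀ t, 0 < t → lagrangePQ N (1 + t) = lagrangePQ N 1 → t ∈ {t : ℕ | 0 < t ∧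
      Function.Periodic (fun m : ℕ => (GenContFract.of √(N : ℝ)).partDens.get? m) t} := by
    intro t ht h
    refine ⟨ht, fun m ↦ ?_⟩
    have := lagrangePQ_add_of_eq h m
    simp only [partDens_sqrt hN]
    rw [show m + t + 1 = 1 + t + m by ring, this, add_comm 1 m]
  obtain ⟨r, hr, hper⟩ := exists_lagrangePQ_period hN
  obtain ⟨h0, hp⟩ := Nat.sInf_mem ⟨r, hmem r hr hper⟩
  refine ⟨h0, lagrangePQ_eq_of_floor_eq hN _ fun m ↦ ?_, fun t ht h ↦ Nat.sInf_le (hmem t ht h)⟩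
  have hm := (partDens_sqrt hN _).symm.trans ((hp m).trans (partDens_sqrt hN m))
  exact Int.cast_injective (Option.some.inj hm)

/-! ### Symmetry of the period and its middle term -/

theorem lagrangePQ_fst_of_snd_eq_one (hN : ¬ IsSquare N) {m : ℕ}
    (h : (lagrangePQ N (m + 1)).2 = 1) : (lagrangePQ N (m + 1)).1 = ⌊√(N : ℝ)⌋ := by
  have h1 := sqrt_sub_lt hN m
  have h2 := (admissible_lagrangePQ hN (m + 1)).lt
  rw [h, Int.cast_one] at h1
  rw [eq_comm, Int.floor_eq_iff]
  exact ⟨h2.le, by linarith⟩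

theorem lagrangePQ_one_fst : (lagrangePQ N 1).1 = ⌊√(N : ℝ)⌋ := by
  simp [lagrangePQ_succ, lagrangePQ_zero, lagrangeStep, completeQuotient]

theorem lagrangePQ_period_of_snd_eq_one (hN : ¬ IsSquare N) {m : ℕ}
    (h : (lagrangePQ N (m + 1)).2 = 1) : lagrangePQ N (1 + (m + 1)) = lagrangePQ N 1 := by
  rw [add_comm 1]
  refine lagrangePQ_ext hN (n := 0) ?_ h
  have h1 := lagrangePQ_fst_of_snd_eq_one hN h
  rw [zero_add, lagrangePQ_one_fst, lagrangePQ_succ, lagrangeStep, completeQuotient, h, h1]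
  simp

theorem lagrangePQ_snd_eq_one_of_period (hN : ¬ IsSquare N) {t : ℕ}
    (h : lagrangePQ N (1 + t) = lagrangePQ N 1) : (lagrangePQ N t).2 = 1 := by
  rw [add_comm] at h
  exact lagrangePQ_snd_eq hN (n := 0) h

/-- Both sides follow the same step map as `i` grows. They agree at `i = 0` because `Q_t = 1` forces
`P_t = ⌊√N⌋ = P_1 = P_{t+1}`. -/
theorem reversePQ_eq_lagrangePQ (hN : ¬ IsSquare N) {t : ℕ} (ht : 0 < t)
    (h : lagrangePQ N (1 + t) = lagrangePQ N 1) {i : ℕ} (hi : i ≤ t) :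
    reversePQ N (t - i) = lagrangePQ N (t + i) := by
  induction i with
  | zero =>
    have h1 := lagrangePQ_snd_eq_one_of_period hN h
    obtain ⟨u, rfl⟩ := Nat.exists_eq_add_of_le' ht
    refine Prod.ext ?_ rfl
    rw [add_comm] at h
    simp only [reversePQ, tsub_zero, add_zero]
    rw [h, lagrangePQ_fst_of_snd_eq_one hN h1, lagrangePQ_one_fst]
  | succ i ih =>
    rw [← add_assoc, lagrangePQ_succ, ← ih (by omega), ← lagrangeStep_reversePQ hN,
      show t - (i + 1) + 1 = t - i by omega]

theorem lagrangePQ_dvd_of_even_period (hN : ¬ IsSquare N) {k : ℕ} (hk : 0 < k)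
    (h : lagrangePQ N (1 + 2 * k) = lagrangePQ N 1) : (lagrangePQ N k).2 ∣ 2 * (N : ℤ) := by
  have h1 := reversePQ_eq_lagrangePQ hN (by omega) h (i := k) (by omega)
  rw [show 2 * k - k = k by omega] at h1
  have h2 : lagrangePQ N (2 * k + k) = lagrangePQ N k := by
    have := lagrangePQ_add_of_eq h (k - 1)
    rwa [show 1 + 2 * k + (k - 1) = 2 * k + k by omega, show 1 + (k - 1) = k by omega] at this
  have h3 : (lagrangePQ N (k + 1)).1 = (lagrangePQ N k).1 := (Prod.ext_iff.1 (h1.trans h2)).1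
  rw [lagrangePQ_succ, lagrangeStep] at h3
  obtain ⟨c, hc⟩ := (admissible_lagrangePQ hN k).dvd
  exact ⟨2 * c + ⌊completeQuotient N (lagrangePQ N k)⌋ * (lagrangePQ N k).1, by
    linear_combination 2 * hc - (lagrangePQ N k).1 * h3⟩

/-! ### The norm equation and its arithmetic consequences -/

/-- Each step multiplies `A + B√N` by `(P' + √N) / Q`, of norm `-Q' / Q`. The divisibility clause
keeps the new coefficients integral. -/
theorem exists_sq_sub_mul_sq_eq (hN : ¬ IsSquare N) (m : ℕ) :
    ∃ A B : ℤ, A ^ 2 - N * B ^ 2 = (-1) ^ m * (lagrangePQ N m).2 ∧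
      (lagrangePQ N m).2 ∣ A - B * (lagrangePQ N m).1 := by
  induction m with
  | zero => exact ⟨1, 0, by simp [lagrangePQ_zero], by simp [lagrangePQ_zero]⟩
  | succ m ih =>
    obtain ⟨A, B, hAB, e, he⟩ := ih
    have hx := admissible_lagrangePQ hN m
    have hmul := lagrangePQ_mul hN m
    obtain ⟨c, hc⟩ := hx.dvd
    have hP : (lagrangePQ N (m + 1)).1 = ⌊completeQuotient N (lagrangePQ N m)⌋ *
      (lagrangePQ N m).2 - (lagrangePQ N m).1 := rfl
    generalize (lagrangePQ N (m + 1)).1 = P' at *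
    generalize (lagrangePQ N (m + 1)).2 = Q' at *
    have hQ0 := hx.pos.ne'
    generalize (lagrangePQ N m).1 = P at *
    generalize (lagrangePQ N m).2 = Q at *
    generalize ⌊completeQuotient N (lagrangePQ N m)⌋ = a at *
    have hA : A * P' + N * B = Q * (a * A + B * c - e * P) := by
      rw [hP]; linear_combination B * hc - P * he
    have hB : A + B * P' = Q * (a * B + e) := by
      rw [hP]; linear_combination he
    refine ⟨a * A + B * c - e * P, a * B + e, ?_, B, ?_⟩
    · refine mul_left_cancel₀ (pow_ne_zero 2 hQ0) ?_
      rw [mul_sub, ← mul_pow, mul_left_comm, ← mul_pow, ← hA, ← hB, pow_succ]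
      linear_combination (P' ^ 2 - N) * hAB + (-1) ^ m * Q * hmul
    · refine mul_left_cancel₀ hQ0 ?_
      rw [mul_sub, ← mul_assoc, ← hA, ← hB]
      linear_combination -B * hmul

theorem lagrangePQ_snd_lt (hN : ¬ IsSquare N) (h4 : 4 ≤ N) (m : ℕ) : (lagrangePQ N m).2 < N := by
  have hx := admissible_lagrangePQ hN m
  have h1 := hx.lt
  have h2 := hx.lt_add
  have h3 : 2 * √(N : ℝ) ≤ N := by
    have hs : √(N : ℝ) ^ 2 = N := Real.sq_sqrt (Nat.cast_nonneg N)
    have h2 : (2 : ℝ) ≤ √(N : ℝ) := Real.le_sqrt_of_sq_le (by norm_num; exact_mod_cast h4)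
    nlinarith
  have : ((lagrangePQ N m).2 : ℝ) < N := by linarith
  exact_mod_cast this

/-- The middle `Q` of an even period has a common factor with an odd `N`, unless it is `2`. -/
theorem containsNontrivialFactor_of_ne_two (hN : ¬ IsSquare N) (h4 : 4 ≤ N)
    (hτ : Even (sqrtPeriod N)) (h2 : (lagrangePQ N (sqrtPeriod N / 2)).2 ≠ 2) :
    ContainsNontrivialFactor (lagrangeQ N (sqrtPeriod N / 2)) N := by
  obtain ⟨h0, hper, hmin⟩ := sqrtPeriod_spec hN
  obtain ⟨k, hk⟩ := hτ
  have hk2 : sqrtPeriod N / 2 = k := by omega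
  have hk0 : 0 < k := by omega
  rw [hk2] at h2 ⊢
  rw [hk, ← two_mul] at hper
  have hdvd := lagrangePQ_dvd_of_even_period hN hk0 hper
  have hpos := (admissible_lagrangePQ hN k).pos
  have hlt := lagrangePQ_snd_lt hN h4 k
  -- `Q_k = 1` would make `k` a period shorter than `τ = 2k`.
  have hne1 : (lagrangePQ N k).2 ≠ 1 := by
    intro h1
    obtain ⟨j, rfl⟩ := Nat.exists_eq_add_of_le' hk0
    have := hmin _ hk0 (lagrangePQ_period_of_snd_eq_one hN h1)
    omega
  rw [ContainsNontrivialFactor, lagrangeQ]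
  constructor
  · by_contra hle
    have hgpos : 0 < Int.gcd (lagrangePQ N k).2 N := Int.gcd_pos_of_ne_zero_left _ hpos.ne'
    have hg : Int.gcd (lagrangePQ N k).2 N = 1 := by omega
    have hd2 : (lagrangePQ N k).2 ∣ 2 := Int.dvd_of_dvd_mul_left_of_gcd_one hdvd hg
    have := Int.le_of_dvd two_pos hd2
    omega
  · have := Int.le_of_dvd hpos (Int.gcd_dvd_left (lagrangePQ N k).2 N)
    omega

/-- As `Q_τ = 1`, an odd `τ` would make `-1` a square mod `q`. -/
theorem even_sqrtPeriod (hN : ¬ IsSquare N) {q : ℕ} (hq : q.Prime) (hq4 : q % 4 = 3)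
    (hqN : q ∣ N) : Even (sqrtPeriod N) := by
  obtain ⟨-, hper, -⟩ := sqrtPeriod_spec hN
  by_contra hodd
  rw [Nat.not_even_iff_odd] at hodd
  obtain ⟨A, B, hAB, -⟩ := exists_sq_sub_mul_sq_eq hN (sqrtPeriod N)
  rw [lagrangePQ_snd_eq_one_of_period hN hper, hodd.neg_one_pow] at hAB
  have := Fact.mk hq
  have h := congrArg (Int.cast : ℤ → ZMod q) hAB
  push_cast at h
  rw [(ZMod.natCast_eq_zero_iff N q).2 hqN, zero_mul, sub_zero] at h
  exact ZMod.mod_four_ne_three_of_sq_eq_neg_one h hq4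

/-- A difference of two squares is never `2` mod `4`. -/
theorem lagrangePQ_snd_ne_two_of_mod_four (hN : ¬ IsSquare N) (h1 : N % 4 = 1) (m : ℕ) :
    (lagrangePQ N m).2 ≠ 2 := by
  intro h2
  obtain ⟨A, B, hAB, -⟩ := exists_sq_sub_mul_sq_eq hN m
  rw [h2] at hAB
  have hN4 : (N : ZMod 4) = 1 := by
    rw [← ZMod.natCast_mod, h1, Nat.cast_one]
  have h := congrArg (Int.cast : ℤ → ZMod 4) hAB
  push_cast at h
  rw [hN4, one_mul] at h
  have key : ∀ a b : ZMod 4, a ^ 2 - b ^ 2 ≠ 2 := by decide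
  rcases neg_one_pow_eq_or (ZMod 4) m with hm | hm
  · rw [hm, one_mul] at h
    exact key _ _ h
  · rw [hm, neg_one_mul, show (-2 : ZMod 4) = 2 by decide] at h
    exact key _ _ h

/-- Neither `2` nor `-2` is a square mod `p` when `p ≡ 5 mod 8`. -/
theorem lagrangePQ_snd_ne_two_of_dvd (hN : ¬ IsSquare N) {p : ℕ} (hp : p.Prime) (hp8 : p % 8 = 5)
    (hpN : p ∣ N) (m : ℕ) : (lagrangePQ N m).2 ≠ 2 := by
  intro h2
  obtain ⟨A, B, hAB, -⟩ := exists_sq_sub_mul_sq_eq hN m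
  rw [h2] at hAB
  have := Fact.mk hp
  have hp2 : p ≠ 2 := by rintro rfl; omega
  have h := congrArg (Int.cast : ℤ → ZMod p) hAB
  push_cast at h
  rw [(ZMod.natCast_eq_zero_iff N p).2 hpN, zero_mul, sub_zero] at h
  rcases neg_one_pow_eq_or (ZMod p) m with hm | hm
  · rw [hm, one_mul] at h
    have := (ZMod.exists_sq_eq_two_iff hp2).1 ⟨_, by rw [← h, sq]⟩
    omega
  · rw [hm, neg_one_mul] at h
    have := (ZMod.exists_sq_eq_neg_two_iff hp2).1 ⟨_, by rw [← h, sq]⟩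
    omega

end Lagrange

theorem Nat.Prime.not_isSquare_mul {p q : ℕ} (hp : p.Prime) (hq : q.Prime) (hpq : p ≠ q) :
    ¬ IsSquare (p * q) := by
  rintro ⟨r, hr⟩
  have hpr : p ∣ r := or_self_iff.1 (hp.dvd_mul.1 (hr ▸ Dvd.intro q rfl))
  obtain ⟨c, rfl⟩ := hpr
  have : q = p * (c * c) := Nat.eq_of_mul_eq_mul_left hp.pos (by rw [hr]; ring)
  exact hpq ((Nat.prime_dvd_prime_iff_eq hp hq).1 ⟨_, this⟩)

theorem mainTheorem10 (p q : ℕ) (hp : p.Prime) (hq : q.Prime) (hpq : p ≠ q) :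
    (p ≡ 3 [MOD 4] → q ≡ 3 [MOD 4] →
      Even (sqrtPeriod (p * q)) ∧
        ContainsNontrivialFactor (lagrangeQ (p * q) (sqrtPeriod (p * q) / 2)) (p * q)) ∧
    (p ≡ 5 [MOD 8] → q ≡ 3 [MOD 4] →
      Even (sqrtPeriod (p * q)) ∧
        ContainsNontrivialFactor (lagrangeQ (p * q) (sqrtPeriod (p * q) / 2)) (p * q)) ∧
    (p ≡ 1 [MOD 4] → q ≡ 1 [MOD 4] → Even (sqrtPeriod (p * q)) →
        ContainsNontrivialFactor (lagrangeQ (p * q) (sqrtPeriod (p * q) / 2)) (p * q)) := by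
  have hN := hp.not_isSquare_mul hq hpq
  have h4 : 4 ≤ p * q := Nat.mul_le_mul hp.two_le hq.two_le
  refine ⟨fun h1 h2 ↦ ?_, fun h1 h2 ↦ ?_, fun h1 h2 hτ ↦ ?_⟩
  · have hτ := even_sqrtPeriod hN hq h2 (Dvd.intro_left p rfl)
    exact ⟨hτ, containsNontrivialFactor_of_ne_two hN h4 hτ
      (lagrangePQ_snd_ne_two_of_mod_four hN (h1.mul h2) _)⟩
  · have hτ := even_sqrtPeriod hN hq h2 (Dvd.intro_left p rfl)
    exact ⟨hτ, containsNontrivialFactor_of_ne_two hN h4 hτ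
      (lagrangePQ_snd_ne_two_of_dvd hN hp h1 (Dvd.intro q rfl) _)⟩
  · exact containsNontrivialFactor_of_ne_two hN h4 hτ
      (lagrangePQ_snd_ne_two_of_mod_four hN (h1.mul h2) _)
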